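/- Let $k$ be a field, and let $A$ and $B$ be polynomial rings over $k$ in finite disjoint sets of variables. Let $R=A\otimes_k B$. Let $I\subset A$ and $J\subset B$ be nonzero proper homogeneous ideals (with respect to the standard gradings), let $x\in A$ and $y\in B$ be arbitrary variables, and use the same symbols for elements of $A$ and $B$ and their images in $R$, and for ideals of $A$ and $B$ and their extensions to $R$. For an ideal $Q$ of a Noetherian ring $S$, write $\operatorname{Ass}(Q)$ for the set of associated primes of the $S$-module $S/Q$, and $\operatorname{Min}(Q)$ for the set of minimal primes over $Q$. Then $$\operatorname{Ass}(IJ,x-y)=\{(\mathfrak p,x-y)\mid \mathfrak p\in\operatorname{Ass}(I)\}\ \cup\ \{(\mathfrak q,x-y)\mid \mathfrak q\in\operatorname{Ass}(J)\}\ \cup\bigcup_{\substack{\mathfrak p\in\operatorname{Ass}(I),\ x\in\mathfrak p\\ \mathfrak q\in\operatorname{Ass}(J),\ y\in\mathfrak q}}\operatorname{Min}(\mathfrak p+\mathfrak q).$$ Here $\operatorname{Ass}(IJ,x-y)$ and $\operatorname{Min}(\mathfrak p+\mathfrak q)$ are taken in $R$, while $\operatorname{Ass}(I)$ and $\operatorname{Ass}(J)$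 are taken in $A$ and $B$, respectively. -/

import Mathlib

open scoped TensorProduct

namespace AssProduct

/-- The set `Ass(Q)` of associated primes of an ideal `Q` of a commutative ring `R`, that is,
the associated primes of the `R`-module `R ⧸ Q`. -/
abbrev Ass {R : Type*} [CommRing R] (Q : Ideal R) : Set (Ideal R) :=
  associatedPrimes R (R ⧸ Q)

section

attribute [local instance] MvPolynomial.gradedAlgebra

/-- An ideal of the polynomial ring `k[σ]` is homogeneous with respect to the standard grading
(all variables have degree one). -/
abbrev IsHomogeneous {k σ : Type*} [Field k] (I : Ideal (MvPolynomial σ k)) : Prop :=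
  I.IsHomogeneous (MvPolynomial.homogeneousSubmodule σ k)

end

section

variable {k σ τ : Type*} [Field k]

/-- The extension of an ideal of `A = k[σ]` to `R = A ⊗ₖ B`, where `B = k[τ]`. -/
noncomputable abbrev extLeft (τ : Type*) (I : Ideal (MvPolynomial σ k)) :
    Ideal (MvPolynomial σ k ⊗[k] MvPolynomial τ k) :=
  I.map (Algebra.TensorProduct.includeLeft :
    MvPolynomial σ k →ₐ[k] MvPolynomial σ k ⊗[k] MvPolynomial τ k)

/-- The extension of an ideal of `B = k[τ]` to `R = A ⊗ₖ B`, where `A = k[σ]`. -/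
noncomputable abbrev extRight (σ : Type*) (J : Ideal (MvPolynomial τ k)) :
    Ideal (MvPolynomial σ k ⊗[k] MvPolynomial τ k) :=
  J.map (Algebra.TensorProduct.includeRight :
    MvPolynomial τ k →ₐ[k] MvPolynomial σ k ⊗[k] MvPolynomial τ k)

/-- The principal ideal `(x - y)` of `R = A ⊗ₖ B` for a variable `x` of `A = k[σ]` and a
variable `y` of `B = k[τ]`. -/
noncomputable abbrev diffIdeal (k : Type*) [Field k] (x : σ) (y : τ) :
    Ideal (MvPolynomial σ k ⊗[k] MvPolynomial τ k) :=
  Ideal.span {MvPolynomial.X x ⊗ₜ[k] 1 - 1 ⊗ₜ[k] MvPolynomial.X y}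

end

end AssProduct

/-!
Let `X` act on `A` as `x` and on `B` as `y`. Then `R / (x - y)` is `C = A ⊗ B`, the tensor product
over `S = k[X]` (`ker_glue`), and the associated primes of `(IJ, x - y)` are the preimages of those
of the ideal `IJ C`. As `A` and `B` are polynomial rings over `S`, the ring `C` is flat over both of
them.

The module `C / IJ C` is an extension of `C / J C` by `J C / IJ C = (C ⊗_B J) ⊗_A A / I`
(`ass_mul_subset`, `associatedPrimes_tensor_subset_ass_mul`). The ideal `J` is torsion-free, hence
flat, over the principal ideal domain `S`, so `C ⊗_B J = A ⊗_S J` is flat over `A`. The formula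
`Ass_C (N ⊗_A M) = ⋃ Ass_C (N ⊗_A A / p)`, over `p ∈ Ass M`, for a `C`-module `N` flat over `A`
(`associatedPrimes_flat_tensor`) therefore reduces `J C / IJ C` to the modules `J C / p J C` with
`p ∈ Ass I`, and reduces `C / J C` to the domains `C / q C` with `q ∈ Ass J`.

As `I` is homogeneous, a polynomial in `x` with nonzero constant coefficient is a nonzerodivisor
modulo `I`, so a prime `p ∈ Ass I` either contains `x` or meets `k[x]` in zero.
* If `p` meets `k[x]` in zero, then `A / p` is flat over `S`, so `J C / p J C` embeds in the domain
  `C / p C` and its only associated prime is `p C`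
  (`associatedPrimes_tensor_quotient_of_injective`).
* If `x ∈ p`, then `J C / p J C = A / p ⊗_k J / y J`. Flat base change along
  `B / (y) → A / p ⊗_k B / (y)`, together with
  `Ass (J / y J) = {(y)} ∪ {q ∈ Ass J | y ∈ q}` (`associatedPrimes_quotient_span_singleton_smul`),
  gives the associated primes of the rings `A / p ⊗_k B / q`. These are the minimal primes over
  `p + q`, because a tensor product of finitely generated domains over a field has no embedded
  primes (`mem_minimalPrimes_of_mem_associatedPrimes_tensor`). The prime `q = (y)` contributes
  `p + (y) = p + (x - y)`.

Since `J C / IJ C` is a submodule of `C / IJ C`, this also shows that the primes `(p, x - y)` and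
the minimal primes over `p + q` do occur; the primes `(q, x - y)` occur by symmetry.
-/

namespace AssProduct

/-! ### Associated primes under flat base change -/

section FlatBaseChange

variable {A C : Type*} [CommRing A] [CommRing C] [Algebra A C]

theorem comap_mem_associatedPrimes {M : Type*} [AddCommGroup M] [Module A M] [Module C M]
    [IsScalarTower A C M] {P : Ideal C} (hP : P ∈ associatedPrimes C M) :
    P.comap (algebraMap A C) ∈ associatedPrimes A M := by
  obtain ⟨hprime, m, hm⟩ := hP
  refine ⟨inferInstance, m, ?_⟩
  ext a
  have := congrArg (algebraMap A C a ∈ ·) hm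
  simp only [eq_iff_iff] at this
  rw [Ideal.mem_comap, this]
  simp only [Ideal.mem_radical_iff, Submodule.mem_colon_singleton, ← map_pow, algebraMap_smul]
  rfl

variable [IsNoetherianRing A]
variable (N : Type*) [AddCommGroup N] [Module A N] [Module C N] [IsScalarTower A C N]
  [Module.Flat A N]

/-- An element of `N ⊗ M` killed by an ideal `p` comes from the `p`-torsion of `M`,
when `N` is flat and `p` is finitely generated. -/
theorem exists_lTensor_torsionBySet_eq {M : Type*} [AddCommGroup M] [Module A M] (p : Ideal A)
    (w : N ⊗[A] M) (hw : ∀ a ∈ p, a • w = 0) :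
    ∃ v : N ⊗[A] Submodule.torsionBySet A M (p : Set A),
      LinearMap.lTensor N (Submodule.torsionBySet A M (p : Set A)).subtype v = w := by
  obtain ⟨r, g, hg⟩ := Submodule.fg_iff_exists_fin_generating_family.mp
    (IsNoetherian.noetherian p)
  let φ : M →ₗ[A] (Fin r → M) := LinearMap.pi fun i => LinearMap.lsmul A M (g i)
  have hex : Function.Exact (Submodule.torsionBySet A M (p : Set A)).subtype φ := by
    intro m
    rw [← LinearMap.coe_range, SetLike.mem_coe, Submodule.range_subtype,
      ← Ideal.submodule_span_eq.symm.trans hg, ← Submodule.torsionBySet_eq_torsionBySet_span]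
    simp [φ, funext_iff, Submodule.mem_torsionBySet_iff]
  refine (Module.Flat.lTensor_exact N hex w).mp ?_
  apply (TensorProduct.piRight A A N (fun _ : Fin r => M)).injective
  rw [map_zero]
  have key : ∀ u : N ⊗[A] M, TensorProduct.piRight A A N (fun _ : Fin r => M)
      (LinearMap.lTensor N φ u) = fun i => g i • u := by
    intro u
    induction u with
    | zero => ext; simp
    | tmul n m => ext i; simp [φ]
    | add u v hu hv => rw [map_add, map_add, hu, hv]; ext i; simp
  rw [key]
  ext i
  exact hw _ (hg ▸ Submodule.subset_span ⟨i, rfl⟩)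

/-- An `A`-associated prime `p` of `N ⊗ M` is associated to `M`: otherwise every element of the
`p`-torsion of `M` would be killed by an element outside `p`, and hence so would the element of
`N ⊗ M` with annihilator `p`. -/
theorem mem_associatedPrimes_of_flat_tensor {M : Type*} [AddCommGroup M] [Module A M]
    {p : Ideal A} (hp : p ∈ associatedPrimes A (N ⊗[A] M)) : p ∈ associatedPrimes A M := by
  obtain ⟨hprime, w, hw⟩ := isAssociatedPrime_iff.mp hp
  have hmem : ∀ a : A, a ∈ p ↔ a • w = 0 := fun a => by
    conv_lhs => rw [hw]
    simp [Submodule.mem_colon_singleton]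
  obtain ⟨v, hv⟩ := exists_lTensor_torsionBySet_eq N p w fun a ha => (hmem a).mp ha
  by_contra hcon
  have key : ∀ u : N ⊗[A] Submodule.torsionBySet A M (p : Set A), ∃ s, s ∉ p ∧ s • u = 0 := by
    intro u
    induction u with
    | zero => exact ⟨1, hprime.one_notMem, by simp⟩
    | tmul n m =>
      have : ∃ s, s ∉ p ∧ s • m = 0 := by
        by_contra! h
        refine hcon (isAssociatedPrime_iff.mpr
          ⟨hprime, m, le_antisymm (fun a ha => ?_) fun a ha => ?_⟩)
        · have := (Submodule.mem_torsionBySet_iff _ _).mp m.2 ⟨a, ha⟩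
          simpa [Submodule.mem_colon_singleton] using this
        · by_contra ha'
          refine h a ha' ?_
          ext
          simpa [Submodule.mem_colon_singleton] using ha
      obtain ⟨s, hs, hsm⟩ := this
      exact ⟨s, hs, by rw [← TensorProduct.tmul_smul, hsm, TensorProduct.tmul_zero]⟩
    | add u v hu hv =>
      obtain ⟨s, hs, hsu⟩ := hu
      obtain ⟨t, ht, htv⟩ := hv
      refine ⟨s * t, fun h => (hprime.mem_or_mem h).elim hs ht, ?_⟩
      rw [smul_add, mul_smul, mul_smul, smul_comm, hsu, htv, smul_zero, smul_zero, add_zero]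
  obtain ⟨s, hs, hsv⟩ := key v
  exact hs ((hmem s).mpr (by rw [← hv, ← map_smul, hsv, map_zero]))

theorem comap_eq_of_mem_associatedPrimes_tensor_quotient {p : Ideal A} [p.IsPrime] {P : Ideal C}
    (hP : P ∈ associatedPrimes C (N ⊗[A] (A ⧸ p))) : P.comap (algebraMap A C) = p := by
  have := mem_associatedPrimes_of_flat_tensor N (comap_mem_associatedPrimes (A := A) hP)
  rw [associatedPrimes.eq_singleton_of_isPrimary (Ideal.IsPrime.isPrimary ‹_›)] at this
  rw [this, Ideal.IsPrime.radical ‹_›]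

/-- An associated prime `P` of `N ⊗ M` occurs in `N ⊗ A / p` for the contraction `p` of `P`. A prime
filtration of `M` yields some prime `p`, and flatness forces `p` to be the contraction. -/
theorem mem_associatedPrimes_tensor_quotient_comap {M : Type*} [AddCommGroup M] [Module A M]
    [hM : Module.Finite A M] {P : Ideal C} (hP : P ∈ associatedPrimes C (N ⊗[A] M)) :
    P ∈ associatedPrimes C (N ⊗[A] (A ⧸ P.comap (algebraMap A C))) := by
  induction hM using IsNoetherianRing.induction_on_isQuotientEquivQuotientPrime A with
  | subsingleton M =>
    rw [associatedPrimes.eq_empty_of_subsingleton] at hP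
    exact hP.elim
  | quotient M p f =>
    have e : N ⊗[A] M ≃ₗ[C] N ⊗[A] (A ⧸ p.1) :=
      TensorProduct.AlgebraTensorModule.congr (LinearEquiv.refl C N) f
    rw [LinearEquiv.AssociatedPrimes.eq e] at hP
    have := p.2
    rwa [comap_eq_of_mem_associatedPrimes_tensor_quotient N hP]
  | exact M₁ M₂ M₃ f g hf hg hfg h₁ h₃ =>
    have := associatedPrimes.subset_union_of_exact
      (f := TensorProduct.AlgebraTensorModule.lTensor C N f)
      (g := TensorProduct.AlgebraTensorModule.lTensor C N g)
      (Module.Flat.lTensor_preserves_injective_linearMap f hf)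
      (Module.Flat.lTensor_exact N hfg) hP
    exact this.elim h₁ h₃

/-- The associated primes of `N ⊗ M`, for a `C`-module `N` that is flat over `A`, come from the
fibres of `N` over the associated primes of `M`. -/
theorem associatedPrimes_flat_tensor (M : Type*) [AddCommGroup M] [Module A M]
    [Module.Finite A M] :
    associatedPrimes C (N ⊗[A] M) =
      ⋃ p ∈ associatedPrimes A M, associatedPrimes C (N ⊗[A] (A ⧸ p)) := by
  apply subset_antisymm
  · intro P hP
    exact Set.mem_biUnion (mem_associatedPrimes_of_flat_tensor N (comap_mem_associatedPrimes hP))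
      (mem_associatedPrimes_tensor_quotient_comap N hP)
  · refine Set.iUnion₂_subset fun p hp => ?_
    obtain ⟨-, f, hf⟩ := (isAssociatedPrime_iff_exists_injective_linearMap _ _).mp hp
    exact associatedPrimes.subset_of_injective
      (f := TensorProduct.AlgebraTensorModule.lTensor C N f)
      (Module.Flat.lTensor_preserves_injective_linearMap f hf)

end FlatBaseChange

section Surjective

variable {R C : Type*} [CommRing R] [CommRing C] [Algebra R C]

/-- Restricting scalars along a surjective ring homomorphism pulls back associated primes. -/
theorem associatedPrimes_eq_image_comap (h : Function.Surjective (algebraMap R C))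
    (M : Type*) [AddCommGroup M] [Module R M] [Module C M] [IsScalarTower R C M] :
    associatedPrimes R M = Ideal.comap (algebraMap R C) '' associatedPrimes C M := by
  apply subset_antisymm
  · rintro P ⟨hP, m, hm⟩
    have hcomap : P = ((⊥ : Submodule C M).colon {m}).radical.comap (algebraMap R C) := by
      rw [hm, Ideal.comap_radical]
      congr 1
      ext a
      simp [Submodule.mem_colon_singleton]
    refine ⟨((⊥ : Submodule C M).colon {m}).radical, ⟨?_, m, rfl⟩, hcomap.symm⟩
    rw [hcomap] at hP
    rw [← Ideal.map_comap_of_surjective _ h ((⊥ : Submodule C M).colon {m}).radical]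
    exact Ideal.map_isPrime_of_surjective h (Ideal.comap_mono bot_le)
  · rintro _ ⟨P, hP, rfl⟩
    exact comap_mem_associatedPrimes hP

theorem associatedPrimes_quotient_eq_image_comap (h : Function.Surjective (algebraMap R C))
    (K : Ideal R) (hK : RingHom.ker (algebraMap R C) ≤ K) :
    associatedPrimes R (R ⧸ K) = Ideal.comap (algebraMap R C) ''
      associatedPrimes C (C ⧸ K.map (algebraMap R C)) := by
  rw [← associatedPrimes_eq_image_comap h]
  have hc : (K.map (algebraMap R C)).comap (algebraMap R C) = K := by
    rw [Ideal.comap_map_of_surjective' _ h, sup_eq_left.mpr hK]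
  let φ : R ⧸ K →ₗ[R] C ⧸ K.map (algebraMap R C) :=
    Submodule.mapQ K ((K.map (algebraMap R C)).restrictScalars R) (Algebra.linearMap R C)
      (fun a ha => Ideal.mem_map_of_mem _ ha)
  have hφ : Function.Bijective φ := by
    constructor
    · rw [injective_iff_map_eq_zero]
      intro a ha
      obtain ⟨a, rfl⟩ := Ideal.Quotient.mk_surjective a
      have : algebraMap R C a ∈ K.map (algebraMap R C) := (Submodule.Quotient.mk_eq_zero _).mp ha
      rw [Ideal.Quotient.eq_zero_iff_mem, ← hc]
      exact this
    · intro c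
      obtain ⟨c, rfl⟩ := Ideal.Quotient.mk_surjective c
      obtain ⟨a, rfl⟩ := h c
      exact ⟨Ideal.Quotient.mk K a, rfl⟩
  exact LinearEquiv.AssociatedPrimes.eq (LinearEquiv.ofBijective φ hφ)

variable (N : Type*) [AddCommGroup N] [Module C N]

/-- If `C → C₁` is surjective with kernel `K`, the `C`-module `N / K N` has the associated primes
of the `C₁`-module `C₁ ⊗ N`, pulled back to `C`. -/
theorem associatedPrimes_quotient_smul_top {C₁ : Type*} [CommRing C₁] [Algebra C C₁]
    (h : Function.Surjective (algebraMap C C₁)) {K : Ideal C}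
    (hK : RingHom.ker (algebraMap C C₁) = K) :
    associatedPrimes C (N ⧸ (K • ⊤ : Submodule C N)) =
      Ideal.comap (algebraMap C C₁) '' associatedPrimes C₁ (C₁ ⊗[C] N) := by
  rw [← associatedPrimes_eq_image_comap h]
  subst hK
  let e : (C ⧸ RingHom.ker (algebraMap C C₁)) ≃ₗ[C] C₁ :=
    (Ideal.quotientKerAlgEquivOfSurjective (f := Algebra.ofId C C₁) h).toLinearEquiv
  exact LinearEquiv.AssociatedPrimes.eq ((TensorProduct.quotTensorEquivQuotSMul N _).symm.trans
    (TensorProduct.congr e (LinearEquiv.refl C N)))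

theorem associatedPrimes_tensor_quotient {A : Type*} [CommRing A] [Algebra A C] [Module A N]
    [IsScalarTower A C N] (I : Ideal A) :
    associatedPrimes C (N ⊗[A] (A ⧸ I)) =
      associatedPrimes C (N ⧸ (I.map (algebraMap A C) • ⊤ : Submodule C N)) := by
  let φ : N →ₗ[C] N ⊗[A] (A ⧸ I) :=
    { toFun := fun n => n ⊗ₜ 1
      map_add' := fun a b => TensorProduct.add_tmul _ _ _
      map_smul' := fun c n => rfl }
  have hsurj : Function.Surjective φ := by
    intro w
    induction w with
    | zero => exact ⟨0, map_zero _⟩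
    | tmul n a =>
      obtain ⟨a, rfl⟩ := Ideal.Quotient.mk_surjective a
      refine ⟨a • n, ?_⟩
      change (a • n) ⊗ₜ[A] (1 : A ⧸ I) = _
      rw [TensorProduct.smul_tmul, Algebra.smul_def, mul_one]
      rfl
    | add u v hu hv =>
      obtain ⟨a, rfl⟩ := hu
      obtain ⟨b, rfl⟩ := hv
      exact ⟨a + b, map_add _ _ _⟩
  have hker : LinearMap.ker φ = I.map (algebraMap A C) • (⊤ : Submodule C N) := by
    ext n
    have h1 : n ∈ LinearMap.ker φ ↔ n ∈ (I • ⊤ : Submodule A N) := by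
      rw [← Submodule.Quotient.mk_eq_zero (I • ⊤ : Submodule A N),
        ← (TensorProduct.tensorQuotEquivQuotSMul N I).symm.map_eq_zero_iff,
        TensorProduct.tensorQuotEquivQuotSMul_symm_mk]
      rfl
    have h2 := Ideal.smul_restrictScalars I (⊤ : Submodule C N)
    rw [Submodule.restrictScalars_top] at h2
    rw [h1, ← h2, Submodule.restrictScalars_mem]
  exact (LinearEquiv.AssociatedPrimes.eq ((Submodule.quotEquivOfEq _ _ hker.symm).trans
    (φ.quotKerEquivOfSurjective hsurj))).symm

end Surjective

/-! ### Tensor products of domains over a field -/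

/-- A torsion-free module over a domain has at most one associated prime, the zero ideal. -/
theorem eq_bot_of_mem_associatedPrimes {A M : Type*} [CommRing A] [IsDomain A] [IsNoetherianRing A]
    [AddCommGroup M] [Module A M] [Module.IsTorsionFree A M] {p : Ideal A}
    (hp : p ∈ associatedPrimes A M) : p = ⊥ := by
  obtain ⟨hprime, d, hd⟩ := isAssociatedPrime_iff.mp hp
  have hd0 : d ≠ 0 := by
    rintro rfl
    exact hprime.ne_top (by rw [hd, Submodule.colon_singleton_zero])
  rw [eq_bot_iff]
  intro a ha
  rw [hd, Submodule.mem_colon_singleton, Submodule.mem_bot] at ha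
  exact (smul_eq_zero.mp ha).resolve_right hd0

theorem ker_quotient_mkₐ {k A : Type*} [CommRing k] [CommRing A] [Algebra k A] (I : Ideal A) :
    RingHom.ker (Ideal.Quotient.mkₐ k I) = I :=
  (RingHom.ker_coe_toRingHom _).symm.trans (Ideal.Quotient.mkₐ_ker k I)

theorem isTorsionFree_of_algebraMap_injective {S D : Type*} [CommRing S] [IsDomain S] [CommRing D]
    [IsDomain D] [Algebra S D] (h : Function.Injective (algebraMap S D)) :
    Module.IsTorsionFree S D :=
  have : FaithfulSMul S D := (faithfulSMul_iff_algebraMap_injective S D).mpr h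
  inferInstance

section Field

variable {k : Type*} [Field k]

/-- A tensor product of domains over a field, one of them finitely generated, has no embedded
primes. By Noether normalization `D` is finite and torsion-free over a polynomial ring `D₀`, so
`D ⊗ E` is finite over the domain `D₀ ⊗ E` and its associated primes contract to zero there; primes
of an integral extension over the zero ideal are minimal. -/
theorem mem_minimalPrimes_of_mem_associatedPrimes_tensor (D E : Type*) [CommRing D] [CommRing E]
    [Algebra k D] [Algebra k E] [IsDomain D] [IsDomain E] [Algebra.FiniteType k D]
    {P : Ideal (D ⊗[k] E)}
    (hP : P ∈ associatedPrimes (D ⊗[k] E) (D ⊗[k] E)) : P ∈ minimalPrimes (D ⊗[k] E) := by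
  obtain ⟨s, g, hg, hfin⟩ := exists_finite_inj_algHom_of_fg k D
  let D₀ := MvPolynomial (Fin s) k
  let : Algebra D₀ D := g.toRingHom.toAlgebra
  have : IsScalarTower k D₀ D := IsScalarTower.of_algebraMap_eq fun c => (g.commutes c).symm
  have : Module.Finite D₀ D := hfin
  have : Module.IsTorsionFree D₀ D := isTorsionFree_of_algebraMap_injective hg
  let Λ := D₀ ⊗[k] E
  let T := D ⊗[k] E
  have : IsDomain Λ := ((Algebra.TensorProduct.comm k D₀ E).trans
    ((MvPolynomial.algebraTensorAlgEquiv k E).restrictScalars k)).toMulEquiv.isDomain _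
  let algΛ : Algebra Λ T := (Algebra.TensorProduct.map g (AlgHom.id k E)).toRingHom.toAlgebra
  have : IsScalarTower D₀ Λ T := IsScalarTower.of_algebraMap_eq fun c => by
    change algebraMap D₀ D c ⊗ₜ 1 = Algebra.TensorProduct.map g (AlgHom.id k E) (c ⊗ₜ 1)
    simp; rfl
  have : Module.Flat D₀ Λ := inferInstance
  -- `T = Λ ⊗ D` over `D₀`
  have : Algebra.IsPushout D₀ D Λ T :=
    Algebra.IsPushout.tensorProduct_tensorProduct k E D₀ D
      (by ext; simp [RingHom.algebraMap_toAlgebra])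
  have : Algebra.IsPushout D₀ Λ D T := this.symm
  let e : Λ ⊗[D₀] D ≃ₐ[Λ] T := Algebra.IsPushout.equiv D₀ Λ D T
  have : Module.Finite Λ T := Module.Finite.equiv e.toLinearEquiv
  have h0 : P.comap (algebraMap Λ T) = ⊥ := by
    have h := comap_mem_associatedPrimes (A := Λ) hP
    rw [← LinearEquiv.AssociatedPrimes.eq e.toLinearEquiv] at h
    have h' := mem_associatedPrimes_tensor_quotient_comap (A := D₀) Λ h
    have hc : (P.comap (algebraMap Λ T)).comap (algebraMap D₀ Λ) = ⊥ :=
      eq_bot_of_mem_associatedPrimes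
        (mem_associatedPrimes_of_flat_tensor Λ (comap_mem_associatedPrimes (A := D₀) h))
    rw [hc, ← LinearEquiv.AssociatedPrimes.eq (Ideal.qoutMapEquivTensorQout Λ),
      Ideal.map_bot] at h'
    rw [h'.eq_radical Ideal.isPrime_bot.isPrimary, Ideal.isPrime_bot.radical]
  have : P.IsPrime := hP.1
  refine ⟨⟨inferInstance, bot_le⟩, fun Q ⟨hQ, _⟩ hQP => ?_⟩
  by_contra hlt
  have := Ideal.IsIntegral.comap_lt_comap (R := Λ) (lt_of_le_not_ge hQP hlt)
  rw [h0] at this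
  exact not_lt_bot this

theorem map_quotient_quotient_surjective {A B : Type*} [CommRing A] [CommRing B] [Algebra k A]
    [Algebra k B] (p : Ideal A) (b : Ideal B) :
    Function.Surjective
      (Algebra.TensorProduct.map (Ideal.Quotient.mkₐ k p) (Ideal.Quotient.mkₐ k b)) :=
  Algebra.TensorProduct.map_surjective (Ideal.Quotient.mkₐ k p) (Ideal.Quotient.mkₐ k b)
    (Ideal.Quotient.mkₐ_surjective k p) (Ideal.Quotient.mkₐ_surjective k b)

theorem ker_map_quotient_quotient {A B : Type*} [CommRing A] [CommRing B] [Algebra k A]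
    [Algebra k B] (p : Ideal A) (b : Ideal B) :
    RingHom.ker (Algebra.TensorProduct.map (Ideal.Quotient.mkₐ k p) (Ideal.Quotient.mkₐ k b)) =
      p.map (Algebra.TensorProduct.includeLeft : A →ₐ[k] A ⊗[k] B) ⊔
        b.map (Algebra.TensorProduct.includeRight : B →ₐ[k] A ⊗[k] B) := by
  rw [Algebra.TensorProduct.map_ker _ _ (Ideal.Quotient.mkₐ_surjective k p)
    (Ideal.Quotient.mkₐ_surjective k b), ker_quotient_mkₐ, ker_quotient_mkₐ]

/-- The associated primes of `p + q` in `A ⊗ B`, for primes `p` of `A` and `q` of `B`, are the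
minimal primes over it. -/
theorem associatedPrimes_quotient_extLeft_sup_extRight {A B : Type*} [CommRing A] [CommRing B]
    [Algebra k A] [Algebra k B] [Algebra.FiniteType k A] [Algebra.FiniteType k B]
    (p : Ideal A) (q : Ideal B) [p.IsPrime] [q.IsPrime] :
    Ass (p.map (Algebra.TensorProduct.includeLeft : A →ₐ[k] A ⊗[k] B) ⊔
        q.map (Algebra.TensorProduct.includeRight : B →ₐ[k] A ⊗[k] B)) =
      (p.map (Algebra.TensorProduct.includeLeft : A →ₐ[k] A ⊗[k] B) ⊔
        q.map (Algebra.TensorProduct.includeRight : B →ₐ[k] A ⊗[k] B)).minimalPrimes := by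
  let f : A ⊗[k] B →ₐ[k] (A ⧸ p) ⊗[k] (B ⧸ q) :=
    Algebra.TensorProduct.map (Ideal.Quotient.mkₐ k p) (Ideal.Quotient.mkₐ k q)
  have hf : Function.Surjective f := map_quotient_quotient_surjective p q
  have hker : RingHom.ker f = _ := ker_map_quotient_quotient p q
  have : Algebra.FiniteType k (A ⊗[k] B) := Algebra.FiniteType.trans (S := A) ‹_› inferInstance
  have : IsNoetherianRing (A ⊗[k] B) := Algebra.FiniteType.isNoetherianRing k _
  rw [← hker]
  apply subset_antisymm
  · intro P hP
    let : Algebra (A ⊗[k] B) ((A ⧸ p) ⊗[k] (B ⧸ q)) := f.toRingHom.toAlgebra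
    have h := associatedPrimes_quotient_eq_image_comap (R := A ⊗[k] B) hf (RingHom.ker f) le_rfl
    change Ass (RingHom.ker f) = _ at h
    rw [h] at hP
    obtain ⟨Q, hQ, rfl⟩ := hP
    have hbot : (RingHom.ker f).map (algebraMap (A ⊗[k] B) ((A ⧸ p) ⊗[k] (B ⧸ q))) = ⊥ :=
      (Ideal.map_eq_bot_iff_le_ker _).mpr le_rfl
    rw [hbot, LinearEquiv.AssociatedPrimes.eq (Submodule.quotEquivOfEqBot _ rfl)] at hQ
    have := mem_minimalPrimes_of_mem_associatedPrimes_tensor _ _ hQ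
    exact Ideal.minimalPrimes_comap_of_surjective (f := f.toRingHom) hf this
  · have h := Module.associatedPrimes.minimalPrimes_annihilator_subset_associatedPrimes (A ⊗[k] B)
      ((A ⊗[k] B) ⧸ RingHom.ker f)
    rwa [Ideal.annihilator_quotient] at h

end Field

/-! ### The quotient `J / yJ` and the submodule `J C / IJ C` of `C / IJ C` -/

theorem mem_associatedPrimes_quotient_iff {C N : Type*} [CommRing C] [IsNoetherianRing C]
    [AddCommGroup N] [Module C N] {K : Submodule C N} {P : Ideal C} :
    P ∈ associatedPrimes C (N ⧸ K) ↔ P.IsPrime ∧ ∃ n : N, ∀ u : C, u ∈ P ↔ u • n ∈ K := by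
  rw [AssociatedPrimes.mem_iff, isAssociatedPrime_iff]
  refine and_congr_right fun _ => ⟨?_, ?_⟩
  · rintro ⟨n, rfl⟩
    obtain ⟨n, rfl⟩ := K.mkQ_surjective n
    refine ⟨n, fun u => ?_⟩
    rw [Submodule.mem_colon_singleton, Submodule.mem_bot, ← map_smul, Submodule.mkQ_apply,
      Submodule.Quotient.mk_eq_zero]
  · rintro ⟨n, hn⟩
    refine ⟨K.mkQ n, ?_⟩
    ext u
    rw [hn, Submodule.mem_colon_singleton, Submodule.mem_bot, ← map_smul, Submodule.mkQ_apply,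
      Submodule.Quotient.mk_eq_zero]

theorem mem_ass_iff {C : Type*} [CommRing C] [IsNoetherianRing C] {K P : Ideal C} :
    P ∈ Ass K ↔ P.IsPrime ∧ ∃ n : C, ∀ u : C, u ∈ P ↔ u * n ∈ K :=
  mem_associatedPrimes_quotient_iff

/-- The associated primes of `J / yJ` for a prime element `y` of a Noetherian domain. Elements of
`J` divisible by `y` account for the submodule `(J : y) / J` of `B / J`, the others for `(y)`. -/
theorem associatedPrimes_quotient_span_singleton_smul {B : Type*} [CommRing B] [IsDomain B]
    [IsNoetherianRing B] {y : B} (hy : Prime y) {J : Ideal B} (hJ : J ≠ ⊥) :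
    associatedPrimes B (J ⧸ (Ideal.span {y} • ⊤ : Submodule B J)) =
      {Ideal.span {y}} ∪ {q | q ∈ Ass J ∧ y ∈ q} := by
  have hmem : ∀ n : J, n ∈ (Ideal.span {y} • ⊤ : Submodule B J) ↔ ∃ b ∈ J, (n : B) = y * b := by
    intro n
    rw [Submodule.ideal_span_singleton_smul, Submodule.mem_smul_pointwise_iff_exists]
    constructor
    · rintro ⟨m, -, rfl⟩
      exact ⟨m, m.2, rfl⟩
    · rintro ⟨b, hb, h⟩
      exact ⟨⟨b, hb⟩, trivial, Subtype.ext h.symm⟩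
  have hyprime : (Ideal.span {y}).IsPrime := (Ideal.span_singleton_prime hy.ne_zero).mpr hy
  ext q
  rw [mem_associatedPrimes_quotient_iff]
  simp only [hmem, Set.mem_union, Set.mem_singleton_iff, Set.mem_ofPred_eq, mem_ass_iff,
    Submodule.coe_smul, smul_eq_mul]
  constructor
  · rintro ⟨hq, n, hn⟩
    have hyq : y ∈ q := (hn y).mpr ⟨n, n.2, rfl⟩
    by_cases h : y ∣ (n : B)
    · obtain ⟨b, hb⟩ := h
      refine Or.inr ⟨⟨hq, b, fun u => ?_⟩, hyq⟩
      rw [hn, hb]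
      constructor
      · rintro ⟨c, hc, h⟩
        rw [mul_left_cancel₀ hy.ne_zero ((mul_left_comm y u b).trans h)]
        exact hc
      · intro h
        exact ⟨_, h, mul_left_comm _ _ _⟩
    · refine Or.inl (le_antisymm (fun u hu => ?_) ((Ideal.span_singleton_le_iff_mem _).mpr hyq))
      obtain ⟨c, -, hc⟩ := (hn u).mp hu
      exact Ideal.mem_span_singleton.mpr ((hy.dvd_or_dvd ⟨c, hc⟩).resolve_right h)
  · rintro (rfl | ⟨⟨hq, b, hb⟩, hyq⟩)
    · -- an element of `J` of least order at `y` generates a copy of `B / (y)`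
      obtain ⟨b₀, hb₀, hb₀0⟩ := Submodule.exists_mem_ne_zero_of_ne_bot hJ
      have hex : ∃ n, ∃ b ∈ J, ¬ y ^ (n + 1) ∣ b := by
        obtain ⟨n, hn⟩ := FiniteMultiplicity.of_not_isUnit hy.not_isUnit hb₀0
        exact ⟨n, b₀, hb₀, hn⟩
      classical
      obtain ⟨b, hb, hndvd⟩ := Nat.find_spec hex
      have hdvd : ∀ c ∈ J, y ^ Nat.find hex ∣ c := by
        intro c hc
        rcases hn : Nat.find hex with _ | n
        · simp
        · by_contra h
          exact Nat.find_min hex (m := n) (by omega) ⟨c, hc, h⟩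
      refine ⟨hyprime, ⟨b, hb⟩, fun u => ?_⟩
      rw [Ideal.mem_span_singleton]
      constructor
      · rintro ⟨v, rfl⟩
        exact ⟨v * b, J.mul_mem_left _ hb, mul_assoc _ _ _⟩
      · rintro ⟨c, hc, h⟩
        obtain ⟨b', hb'⟩ := hdvd b hb
        obtain ⟨c', hc'⟩ := hdvd c hc
        have hyb' : ¬ y ∣ b' := fun ⟨d, hd⟩ => hndvd ⟨d, by rw [hb', hd, pow_succ, mul_assoc]⟩
        refine (hy.dvd_or_dvd ⟨c', ?_⟩).resolve_right hyb'
        refine mul_left_cancel₀ (pow_ne_zero (Nat.find hex) hy.ne_zero) ?_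
        simp only [hb', hc'] at h
        linear_combination h
    · refine ⟨hq, ⟨y * b, (mul_comm y b) ▸ mul_comm b y ▸ (hb y).mp hyq⟩, fun u => ?_⟩
      rw [hb]
      constructor
      · intro h
        exact ⟨_, h, mul_left_comm _ _ _⟩
      · rintro ⟨c, hc, h⟩
        rw [mul_left_cancel₀ hy.ne_zero ((mul_left_comm y u b).trans h)]
        exact hc

section Product

variable {A B C : Type*} [CommRing A] [CommRing B] [CommRing C] [Algebra A C] [Algebra B C]

variable (C) in
/-- The multiplication map `C ⊗ J → C` of an ideal `J` of `B`. -/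
noncomputable def tensorIdealMul (J : Ideal B) : C ⊗[B] J →ₗ[C] C :=
  (TensorProduct.AlgebraTensorModule.rid B C C).toLinearMap ∘ₗ
    TensorProduct.AlgebraTensorModule.lTensor C C J.subtype

theorem tensorIdealMul_tmul (J : Ideal B) (c : C) (b : J) :
    tensorIdealMul C J (c ⊗ₜ b) = c * algebraMap B C b := by
  simp [tensorIdealMul, Algebra.smul_def, mul_comm]

theorem tensorIdealMul_injective [Module.Flat B C] (J : Ideal B) :
    Function.Injective (tensorIdealMul C J) :=
  (TensorProduct.AlgebraTensorModule.rid B C C).injective.comp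
    (Module.Flat.lTensor_preserves_injective_linearMap _ J.injective_subtype)

theorem range_tensorIdealMul (J : Ideal B) :
    LinearMap.range (tensorIdealMul C J) = J.map (algebraMap B C) := by
  apply le_antisymm
  · rintro _ ⟨w, rfl⟩
    induction w with
    | zero => simp
    | tmul c b =>
      rw [tensorIdealMul_tmul]
      exact Ideal.mul_mem_left _ _ (Ideal.mem_map_of_mem _ b.2)
    | add u v hu hv => rw [map_add]; exact add_mem hu hv
  · refine Ideal.map_le_iff_le_comap.mpr fun b hb => ⟨1 ⊗ₜ ⟨b, hb⟩, ?_⟩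
    rw [tensorIdealMul_tmul, one_mul]

variable [Module.Flat B C]

theorem comap_tensorIdealMul (K : Ideal C) (J : Ideal B) :
    Submodule.comap (tensorIdealMul C J) (K * J.map (algebraMap B C) : Ideal C) = K • ⊤ := by
  rw [← range_tensorIdealMul, LinearMap.range_eq_map, ← smul_eq_mul, ← Submodule.map_smul'',
    Submodule.comap_map_eq_of_injective (tensorIdealMul_injective J)]

/-- The tensor product `(C ⊗ J) ⊗ A / I` is the submodule `J C / IJ C` of `C / IJ C`. -/
theorem associatedPrimes_tensor_subset_ass_mul (I : Ideal A) (J : Ideal B) :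
    associatedPrimes C ((C ⊗[B] J) ⊗[A] (A ⧸ I)) ⊆
      Ass (I.map (algebraMap A C) * J.map (algebraMap B C)) := by
  rw [associatedPrimes_tensor_quotient]
  refine associatedPrimes.subset_of_injective
    (f := Submodule.mapQ _ _ (tensorIdealMul C J) (comap_tensorIdealMul _ J).ge) ?_
  rw [← LinearMap.ker_eq_bot, Submodule.ker_mapQ, comap_tensorIdealMul]
  exact Submodule.mkQ_map_self _

/-- The module `C / IJ C` is an extension of `C / J C` by `(C ⊗ J) ⊗ A / I`. -/
theorem ass_mul_subset (I : Ideal A) (J : Ideal B) :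
    Ass (I.map (algebraMap A C) * J.map (algebraMap B C)) ⊆
      associatedPrimes C ((C ⊗[B] J) ⊗[A] (A ⧸ I)) ∪ Ass (J.map (algebraMap B C)) := by
  rw [associatedPrimes_tensor_quotient]
  refine associatedPrimes.subset_union_of_exact
    (f := Submodule.mapQ _ _ (tensorIdealMul C J) (comap_tensorIdealMul _ J).ge)
    (g := Submodule.factor Ideal.mul_le_right) ?_ ?_
  · rw [← LinearMap.ker_eq_bot, Submodule.ker_mapQ, comap_tensorIdealMul]
    exact Submodule.mkQ_map_self _
  · rw [LinearMap.exact_iff, Submodule.range_mapQ, range_tensorIdealMul]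
    simp [Submodule.factor, Submodule.ker_mapQ]

end Product

/-! ### Tensor products over a Dedekind domain -/

/-- The associated primes of `B / (y) ⊗ J = J / yJ`, pulled back to `B`. -/
theorem image_comap_mk_associatedPrimes_tensor {B : Type*} [CommRing B] [IsDomain B]
    [IsNoetherianRing B] {y : B} (hy : Prime y) {J : Ideal B} (hJ : J ≠ ⊥) :
    Ideal.comap (algebraMap B (B ⧸ Ideal.span {y})) ''
        associatedPrimes (B ⧸ Ideal.span {y}) ((B ⧸ Ideal.span {y}) ⊗[B] J) =
      {Ideal.span {y}} ∪ {q | q ∈ Ass J ∧ y ∈ q} := by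
  have hker : RingHom.ker (algebraMap B (B ⧸ Ideal.span {y})) = Ideal.span {y} := Ideal.mk_ker
  rw [← associatedPrimes_quotient_span_singleton_smul hy hJ]
  exact (associatedPrimes_quotient_smul_top J Ideal.Quotient.mk_surjective hker).symm

section

attribute [local instance] Algebra.TensorProduct.rightAlgebra

theorem flat_right {S A B : Type*} [CommRing S] [CommRing A] [CommRing B] [Algebra S A]
    [Algebra S B] [Module.Flat S A] : Module.Flat B (A ⊗[S] B) :=
  Module.Flat.isBaseChange S B A _ (Algebra.IsPushout.out (R := S) (S := B) (R' := A))

/-- For an ideal `J` of `B` and `C = A ⊗ B`, the module `C ⊗ J` is flat over `A`, the base ring `S`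
being a Dedekind domain: the torsion-free `S`-module `J` is flat, and `C ⊗ J = A ⊗ J`. -/
theorem flat_tensor_ideal {S A B : Type*} [CommRing S] [IsDedekindDomain S]
    [CommRing A] [CommRing B] [Algebra S A] [Algebra S B] [Module.IsTorsionFree S B] (J : Ideal B) :
    Module.Flat A ((A ⊗[S] B) ⊗[B] J) := by
  have : Module.IsTorsionFree S J := inferInstance
  exact Module.Flat.of_linearEquiv (Algebra.IsPushout.cancelBaseChange S A B (A ⊗[S] B) J)

section

variable {A B C : Type*} [CommRing A] [CommRing B] [CommRing C] [Algebra A C] [Algebra B C]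

/-- The module `(C ⊗ J) ⊗ A / p` is `C₁ ⊗ J`, where `C₁ = C / p C`. -/
theorem associatedPrimes_tensor_quotient_eq_image_comap {C₁ : Type*} [CommRing C₁] [Algebra C C₁]
    [Algebra B C₁] [IsScalarTower B C C₁] (h : Function.Surjective (algebraMap C C₁))
    {p : Ideal A} (hp : RingHom.ker (algebraMap C C₁) = p.map (algebraMap A C)) (J : Ideal B) :
    associatedPrimes C ((C ⊗[B] J) ⊗[A] (A ⧸ p)) =
      Ideal.comap (algebraMap C C₁) '' associatedPrimes C₁ (C₁ ⊗[B] J) := by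
  rw [associatedPrimes_tensor_quotient, associatedPrimes_quotient_smul_top _ h hp,
    LinearEquiv.AssociatedPrimes.eq
      (TensorProduct.AlgebraTensorModule.cancelBaseChange B C C₁ C₁ J)]

end

theorem associatedPrimes_tensor_ideal_of_tower {B B₁ C₁ : Type*} [CommRing B] [CommRing B₁]
    [CommRing C₁] [Algebra B B₁] [Algebra B C₁] [Algebra B₁ C₁] [IsScalarTower B B₁ C₁]
    [Module.Flat B₁ C₁] [IsNoetherianRing B] [IsNoetherianRing B₁] (J : Ideal B) :
    associatedPrimes C₁ (C₁ ⊗[B] J) =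
      ⋃ q ∈ associatedPrimes B₁ (B₁ ⊗[B] J), Ass (q.map (algebraMap B₁ C₁)) := by
  have h := associatedPrimes_flat_tensor (A := B₁) (C := C₁) C₁ (B₁ ⊗[B] J)
  rw [LinearEquiv.AssociatedPrimes.eq
      (TensorProduct.AlgebraTensorModule.cancelBaseChange B B₁ C₁ C₁ J)] at h
  rw [h]
  exact Set.iUnion₂_congr fun q _ =>
    (LinearEquiv.AssociatedPrimes.eq (Ideal.qoutMapEquivTensorQout C₁)).symm

/-- If `B → C / p C = C₁` factors through a ring `B₁` over which `C₁` is flat, the associated primes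
of `(C ⊗ J) ⊗ A / p` are controlled by those of the `B₁`-module `B₁ ⊗ J`. -/
theorem associatedPrimes_tensor_quotient_of_factor {A B C B₁ C₁ : Type*} [CommRing A] [CommRing B]
    [CommRing C] [CommRing B₁] [CommRing C₁] [Algebra A C] [Algebra B C] [Algebra B B₁]
    [Algebra B₁ C₁] [Module.Flat B₁ C₁] [IsNoetherianRing B] [IsNoetherianRing B₁] (ρ : C →+* C₁)
    (hsurj : Function.Surjective ρ) {p : Ideal A} (hker : RingHom.ker ρ = p.map (algebraMap A C))
    (hcomm : ∀ b, ρ (algebraMap B C b) = algebraMap B₁ C₁ (algebraMap B B₁ b)) (J : Ideal B) :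
    associatedPrimes C ((C ⊗[B] J) ⊗[A] (A ⧸ p)) =
      Ideal.comap ρ '' ⋃ q ∈ associatedPrimes B₁ (B₁ ⊗[B] J), Ass (q.map (algebraMap B₁ C₁)) := by
  let : Algebra C C₁ := ρ.toAlgebra
  let : Algebra B C₁ := ((algebraMap B₁ C₁).comp (algebraMap B B₁)).toAlgebra
  have : IsScalarTower B B₁ C₁ := IsScalarTower.of_algebraMap_eq fun b => rfl
  have : IsScalarTower B C C₁ := IsScalarTower.of_algebraMap_eq fun b => (hcomm b).symm
  rw [← associatedPrimes_tensor_ideal_of_tower]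
  exact associatedPrimes_tensor_quotient_eq_image_comap hsurj hker J

/-- Base change along a polynomial ring preserves domains. -/
theorem isDomain_tensor {S B D ι : Type*} [CommRing S] [CommRing B] [CommRing D] [Algebra S B]
    [Algebra S D] [IsDomain D] (e : B ≃ₐ[S] MvPolynomial ι S) : IsDomain (D ⊗[S] B) :=
  ((Algebra.TensorProduct.congr AlgEquiv.refl e : D ⊗[S] B ≃ₐ[D] D ⊗[S] MvPolynomial ι S).trans
    (MvPolynomial.algebraTensorAlgEquiv S D)).toMulEquiv.isDomain _

section

variable {S A B ι : Type*} [CommRing S] [CommRing A] [CommRing B] [Algebra S A] [Algebra S B]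

theorem ker_map_quotient (p : Ideal A) :
    RingHom.ker (Algebra.TensorProduct.map (Ideal.Quotient.mkₐ S p) (AlgHom.id S B)) =
      p.map (algebraMap A (A ⊗[S] B)) := by
  have h : RingHom.ker (Algebra.TensorProduct.map (Ideal.Quotient.mkₐ S p) (AlgHom.id S B)) =
      (RingHom.ker (Ideal.Quotient.mkₐ S p)).map
        (Algebra.TensorProduct.includeLeft : A →ₐ[S] A ⊗[S] B) :=
    Algebra.TensorProduct.rTensor_ker _ (Ideal.Quotient.mkₐ_surjective S p)
  rw [ker_quotient_mkₐ] at h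
  exact h

theorem isPrime_map_left (e : B ≃ₐ[S] MvPolynomial ι S) (p : Ideal A) [p.IsPrime] :
    (p.map (algebraMap A (A ⊗[S] B))).IsPrime := by
  have : IsDomain ((A ⧸ p) ⊗[S] B) := isDomain_tensor e
  rw [← ker_map_quotient]
  exact RingHom.ker_isPrime _

theorem isPrime_map_right (e : A ≃ₐ[S] MvPolynomial ι S) (q : Ideal B) [q.IsPrime] :
    (q.map (algebraMap B (A ⊗[S] B))).IsPrime := by
  have := isPrime_map_left e q (A := B) (B := A)
  let f := (Algebra.TensorProduct.comm S A B).toRingEquiv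
  have h : q.map (algebraMap B (A ⊗[S] B)) = (q.map (algebraMap B (B ⊗[S] A))).comap f := by
    rw [← Ideal.map_symm]
    exact (Ideal.map_map (algebraMap B (B ⊗[S] A)) (f.symm : B ⊗[S] A →+* A ⊗[S] B)).symm
  rw [h]
  infer_instance

/-- When `A` is a polynomial ring over `S`, the associated primes of the extension of `J` to `A ⊗ B`
are the extensions of those of `J`. -/
theorem ass_map_right [IsNoetherianRing B] [IsNoetherianRing (A ⊗[S] B)]
    (e : A ≃ₐ[S] MvPolynomial ι S) (J : Ideal B) :
    Ass (J.map (algebraMap B (A ⊗[S] B))) =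
      (fun q : Ideal B => q.map (algebraMap B (A ⊗[S] B))) '' Ass J := by
  have : Module.Flat S A := Module.Flat.of_linearEquiv e.toLinearEquiv
  have : Module.Flat B (A ⊗[S] B) := flat_right
  rw [Ass, LinearEquiv.AssociatedPrimes.eq (Ideal.qoutMapEquivTensorQout _),
    associatedPrimes_flat_tensor, ← Set.biUnion_of_singleton (_ '' _), Set.biUnion_image]
  refine Set.iUnion₂_congr fun q hq => ?_
  have : q.IsPrime := hq.1
  have hqC := isPrime_map_right (B := B) e q
  rw [← LinearEquiv.AssociatedPrimes.eq (Ideal.qoutMapEquivTensorQout _),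
    associatedPrimes.eq_singleton_of_isPrimary hqC.isPrimary, hqC.radical]

/-- Flat base change along `A → A ⊗ B`, for the module `(A ⊗ B) ⊗ J` with `J` an ideal of `B`. -/
theorem associatedPrimes_tensor_ideal_tensor_quotient [IsDedekindDomain S] [IsNoetherianRing A]
    (e : B ≃ₐ[S] MvPolynomial ι S)
    (I : Ideal A) (J : Ideal B) :
    associatedPrimes (A ⊗[S] B) (((A ⊗[S] B) ⊗[B] J) ⊗[A] (A ⧸ I)) =
      ⋃ p ∈ Ass I, associatedPrimes (A ⊗[S] B) (((A ⊗[S] B) ⊗[B] J) ⊗[A] (A ⧸ p)) := by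
  have : Module.Flat S B := Module.Flat.of_linearEquiv e.toLinearEquiv
  have : Module.Flat A ((A ⊗[S] B) ⊗[B] J) := flat_tensor_ideal J
  exact associatedPrimes_flat_tensor _ _

/-- If `A / p` is torsion-free over `S`, the only associated prime of `J C / p J C` is `p C`. -/
theorem associatedPrimes_tensor_quotient_of_injective [IsDedekindDomain S]
    [IsNoetherianRing (A ⊗[S] B)] (e : B ≃ₐ[S] MvPolynomial ι S) (p : Ideal A) [p.IsPrime]
    (hinj : Function.Injective (algebraMap S (A ⧸ p))) {J : Ideal B} (hJ : J ≠ ⊥) :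
    associatedPrimes (A ⊗[S] B) (((A ⊗[S] B) ⊗[B] J) ⊗[A] (A ⧸ p)) =
      {p.map (algebraMap A (A ⊗[S] B))} := by
  have : Module.Flat S B := Module.Flat.of_linearEquiv e.toLinearEquiv
  have : Module.IsTorsionFree S (A ⧸ p) := isTorsionFree_of_algebraMap_injective hinj
  let D := (A ⧸ p) ⊗[S] B
  have : IsDomain D := isDomain_tensor e
  let f := Algebra.TensorProduct.map (Ideal.Quotient.mkₐ S p) (AlgHom.id S B)
  have hf : Function.Surjective f := Algebra.TensorProduct.map_surjective (Ideal.Quotient.mkₐ S p)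
    (AlgHom.id S B) (Ideal.Quotient.mkₐ_surjective S p) Function.surjective_id
  let : Algebra (A ⊗[S] B) D := f.toRingHom.toAlgebra
  have : IsScalarTower B (A ⊗[S] B) D := IsScalarTower.of_algebraMap_eq fun b => by
    change (1 : A ⧸ p) ⊗ₜ[S] b = f (1 ⊗ₜ b)
    simp [f]
  have : Module.Flat B D := flat_right
  have : IsNoetherianRing D := isNoetherianRing_of_surjective _ _ f.toRingHom hf
  have hinjB : Function.Injective (algebraMap B D) :=
    Algebra.TensorProduct.includeRight_injective hinj
  rw [associatedPrimes_tensor_quotient_eq_image_comap (C₁ := D) hf (ker_map_quotient p)]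
  have hD : associatedPrimes D (D ⊗[B] J) = {⊥} := by
    have hsub : associatedPrimes D (D ⊗[B] J) ⊆ {⊥} := fun P hP =>
      eq_bot_of_mem_associatedPrimes
        (associatedPrimes.subset_of_injective (tensorIdealMul_injective J) hP)
    obtain ⟨b, hb, hb0⟩ := Submodule.exists_mem_ne_zero_of_ne_bot hJ
    have : Nontrivial (D ⊗[B] J) := by
      refine ⟨1 ⊗ₜ ⟨b, hb⟩, 0, fun h => hb0 (hinjB ?_)⟩
      have := congrArg (tensorIdealMul D J) h
      rwa [tensorIdealMul_tmul, one_mul, map_zero, ← map_zero (algebraMap B D)] at this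
    exact (associatedPrimes.nonempty D (D ⊗[B] J)).subset_singleton_iff.mp hsub
  rw [hD, Set.image_singleton, ← RingHom.ker_eq_comap_bot]
  congr 1
  exact ker_map_quotient p

end
end

/-! ### From the tensor product over `k` to the one over `k[X]` -/

section

open Polynomial

theorem prime_algebraMap_X {k B ι : Type*} [Field k] [CommRing B] [Algebra k[X] B]
    (e : B ≃ₐ[k[X]] MvPolynomial ι k[X]) :
    Prime (algebraMap k[X] B X) := by
  rw [← MulEquiv.prime_iff e.toMulEquiv]
  change Prime (e _)
  rw [e.commutes]
  exact (MvPolynomial.prime_C_iff ι).mpr Polynomial.prime_X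

attribute [local instance] Algebra.TensorProduct.rightAlgebra

variable (k A B : Type*) [Field k] [CommRing A] [CommRing B] [Algebra k A] [Algebra k B]
  [Algebra k[X] A] [Algebra k[X] B]

/-- The principal ideal of `A ⊗ₖ B` that identifies the two actions of `X`, for `k[X]`-algebras
`A` and `B`. -/
noncomputable def glueIdeal : Ideal (A ⊗[k] B) :=
  Ideal.span {algebraMap k[X] A X ⊗ₜ 1 - 1 ⊗ₜ algebraMap k[X] B X}

variable [IsScalarTower k k[X] A] [IsScalarTower k k[X] B]

/-- The projection `A ⊗ₖ B → A ⊗ B` onto the tensor product over `k[X]`. -/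
noncomputable def glue : A ⊗[k] B →ₐ[k] A ⊗[k[X]] B :=
  Algebra.TensorProduct.mapOfCompatibleSMul k[X] k k A B

theorem glue_surjective : Function.Surjective (glue k A B) :=
  Algebra.TensorProduct.mapOfCompatibleSMul_surjective k[X] k k A B

theorem ker_glue : RingHom.ker (glue k A B) = glueIdeal k A B := by
  apply le_antisymm
  · have key (s : k[X]) : algebraMap k[X] A s ⊗ₜ[k] (1 : B) - 1 ⊗ₜ algebraMap k[X] B s ∈
        glueIdeal k A B := by
      let f : k[X] →ₐ[k] (A ⊗[k] B) ⧸ glueIdeal k A B :=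
        (Ideal.Quotient.mkₐ k _).comp (Algebra.TensorProduct.includeLeft.comp
          (IsScalarTower.toAlgHom k k[X] A))
      let g : k[X] →ₐ[k] (A ⊗[k] B) ⧸ glueIdeal k A B :=
        (Ideal.Quotient.mkₐ k _).comp (Algebra.TensorProduct.includeRight.comp
          (IsScalarTower.toAlgHom k k[X] B))
      have hfg : f = g := by
        refine Polynomial.algHom_ext ?_
        refine Ideal.Quotient.eq.mpr ?_
        exact Ideal.mem_span_singleton_self _
      exact Ideal.Quotient.eq.mp (DFunLike.congr_fun hfg s)
    intro w hw
    have hw' : w ∈ (TensorProduct.mapOfCompatibleSMul k[X] k k[X] A B).ker := hw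
    rw [TensorProduct.AlgebraTensorModule.ker_mapOfCompatibleSMul] at hw'
    clear hw
    induction hw' using Submodule.span_induction with
    | zero => exact zero_mem _
    | add u v _ _ hu hv => exact add_mem hu hv
    | mem u hu =>
      obtain ⟨s, a, b, rfl⟩ := hu
      have := Ideal.mul_mem_right (a ⊗ₜ[k] b) _ (key s)
      simpa [sub_mul, Algebra.smul_def] using this
    | smul s u _ hu =>
      rw [Algebra.smul_def]
      exact Ideal.mul_mem_left _ _ hu
  · rw [glueIdeal, Ideal.span_singleton_le_iff_mem, RingHom.mem_ker, map_sub, sub_eq_zero]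
    change algebraMap k[X] A X ⊗ₜ[k[X]] (1 : B) = 1 ⊗ₜ[k[X]] algebraMap k[X] B X
    rw [Algebra.algebraMap_eq_smul_one, Algebra.algebraMap_eq_smul_one, TensorProduct.smul_tmul]

variable {k A B}

theorem map_glue_includeLeft (I : Ideal A) :
    (I.map (Algebra.TensorProduct.includeLeft : A →ₐ[k] A ⊗[k] B)).map (glue k A B) =
      I.map (algebraMap A (A ⊗[k[X]] B)) :=
  Ideal.map_map (Algebra.TensorProduct.includeLeft : A →ₐ[k] A ⊗[k] B).toRingHom
    (glue k A B).toRingHom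

theorem map_glue_includeRight (J : Ideal B) :
    (J.map (Algebra.TensorProduct.includeRight : B →ₐ[k] A ⊗[k] B)).map (glue k A B) =
      J.map (algebraMap B (A ⊗[k[X]] B)) :=
  Ideal.map_map (Algebra.TensorProduct.includeRight : B →ₐ[k] A ⊗[k] B).toRingHom
    (glue k A B).toRingHom

theorem comap_glue_map (K : Ideal (A ⊗[k] B)) :
    (K.map (glue k A B)).comap (glue k A B) = K ⊔ glueIdeal k A B := by
  rw [Ideal.comap_map_of_surjective' _ (glue_surjective k A B), ker_glue]

/-- The associated primes of `K + (x - y)` are pulled back from the tensor product over `k[X]`. -/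
theorem ass_sup_glueIdeal (K : Ideal (A ⊗[k] B)) :
    Ass (K ⊔ glueIdeal k A B) = Ideal.comap (glue k A B) '' Ass (K.map (glue k A B)) := by
  let : Algebra (A ⊗[k] B) (A ⊗[k[X]] B) := (glue k A B).toRingHom.toAlgebra
  have h := associatedPrimes_quotient_eq_image_comap (R := A ⊗[k] B) (C := A ⊗[k[X]] B)
    (glue_surjective k A B) (K ⊔ glueIdeal k A B) ((ker_glue k A B).le.trans le_sup_right)
  have h2 : (K ⊔ glueIdeal k A B).map (glue k A B) = K.map (glue k A B) := by
    rw [Ideal.map_sup, sup_eq_left.mpr]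
    rw [(Ideal.map_eq_bot_iff_le_ker _).mpr (ker_glue k A B).ge]
    exact bot_le
  rw [← h2]
  exact h

end

/-! ### The fibres over primes containing `x` -/

section

open Polynomial

attribute [local instance] Algebra.TensorProduct.rightAlgebra

section

variable {k A B : Type*} [Field k] [CommRing A] [CommRing B] [Algebra k A] [Algebra k B]

/-- The extension of an ideal `q₁` of `B / b` to `A / p ⊗ B / b` has the associated primes of
`p + q`, where `q` is the preimage of `q₁` in `B`. -/
theorem image_comap_ass_map_quotient (p : Ideal A) (b : Ideal B) (q₁ : Ideal (B ⧸ b)) :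
    Ideal.comap (Algebra.TensorProduct.map (Ideal.Quotient.mkₐ k p) (Ideal.Quotient.mkₐ k b)) ''
        Ass (q₁.map (algebraMap (B ⧸ b) ((A ⧸ p) ⊗[k] (B ⧸ b)))) =
      Ass (p.map (Algebra.TensorProduct.includeLeft : A →ₐ[k] A ⊗[k] B) ⊔
        (q₁.comap (Ideal.Quotient.mk b)).map
          (Algebra.TensorProduct.includeRight : B →ₐ[k] A ⊗[k] B)) := by
  let φ := Algebra.TensorProduct.map (Ideal.Quotient.mkₐ k p) (Ideal.Quotient.mkₐ k b)
  let : Algebra (A ⊗[k] B) ((A ⧸ p) ⊗[k] (B ⧸ b)) := φ.toRingHom.toAlgebra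
  have hker := ker_map_quotient_quotient (k := k) p b
  have hp : (p.map (Algebra.TensorProduct.includeLeft : A →ₐ[k] A ⊗[k] B)).map φ = ⊥ :=
    (Ideal.map_eq_bot_iff_le_ker _).mpr (hker.ge.trans' le_sup_left)
  have hq : ((q₁.comap (Ideal.Quotient.mk b)).map
      (Algebra.TensorProduct.includeRight : B →ₐ[k] A ⊗[k] B)).map φ =
      q₁.map (algebraMap (B ⧸ b) ((A ⧸ p) ⊗[k] (B ⧸ b))) := by
    conv_rhs => rw [← Ideal.map_comap_of_surjective _ Ideal.Quotient.mk_surjective q₁]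
    refine (Ideal.map_map (Algebra.TensorProduct.includeRight : B →ₐ[k] A ⊗[k] B).toRingHom
      φ.toRingHom).trans (Eq.trans ?_ (Ideal.map_map _ _).symm)
    congr 1
  have h := associatedPrimes_quotient_eq_image_comap (R := A ⊗[k] B)
    (C := (A ⧸ p) ⊗[k] (B ⧸ b)) (map_quotient_quotient_surjective p b)
    (p.map (Algebra.TensorProduct.includeLeft : A →ₐ[k] A ⊗[k] B) ⊔
        (q₁.comap (Ideal.Quotient.mk b)).map
          (Algebra.TensorProduct.includeRight : B →ₐ[k] A ⊗[k] B))
    (hker.le.trans (sup_le_sup_left (Ideal.map_mono fun c hc => by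
      rw [Ideal.mem_comap, Ideal.Quotient.eq_zero_iff_mem.mpr hc]
      exact zero_mem _) _))
  rw [Ass, Ass, h]
  change _ = Ideal.comap φ '' associatedPrimes _ (_ ⧸ Ideal.map φ _)
  rw [Ideal.map_sup, hp, hq, bot_sup_eq]

end

variable {k A B : Type*} [Field k] [CommRing A] [CommRing B] [Algebra k A] [Algebra k B]
  [Algebra k[X] A] [Algebra k[X] B]

theorem extLeft_sup_extRight_span_eq {p : Ideal A} (hp : algebraMap k[X] A X ∈ p) :
    p.map (Algebra.TensorProduct.includeLeft : A →ₐ[k] A ⊗[k] B) ⊔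
        (Ideal.span {algebraMap k[X] B X}).map
          (Algebra.TensorProduct.includeRight : B →ₐ[k] A ⊗[k] B) =
      p.map (Algebra.TensorProduct.includeLeft : A →ₐ[k] A ⊗[k] B) ⊔ glueIdeal k A B := by
  have hx : algebraMap k[X] A X ⊗ₜ[k] (1 : B) ∈
      p.map (Algebra.TensorProduct.includeLeft : A →ₐ[k] A ⊗[k] B) :=
    Ideal.mem_map_of_mem (Algebra.TensorProduct.includeLeft : A →ₐ[k] A ⊗[k] B) hp
  have hext : (Ideal.span {algebraMap k[X] B X}).map
      (Algebra.TensorProduct.includeRight : B →ₐ[k] A ⊗[k] B) =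
      Ideal.span {1 ⊗ₜ algebraMap k[X] B X} := by
    rw [Ideal.map_span, Set.image_singleton]
    rfl
  rw [hext, glueIdeal]
  apply le_antisymm
  · refine sup_le le_sup_left ((Ideal.span_singleton_le_iff_mem _).mpr ?_)
    have := sub_mem (Ideal.mem_sup_left hx) (Ideal.mem_sup_right (Ideal.mem_span_singleton_self
        (algebraMap k[X] A X ⊗ₜ[k] (1 : B) - 1 ⊗ₜ algebraMap k[X] B X)))
    rwa [sub_sub_cancel] at this
  · refine sup_le le_sup_left ((Ideal.span_singleton_le_iff_mem _).mpr ?_)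
    exact sub_mem (Ideal.mem_sup_left hx) (Ideal.mem_sup_right (Ideal.mem_span_singleton_self _))

variable [IsScalarTower k k[X] A] [IsScalarTower k k[X] B]

/-- When `x ∈ p`, the ring `A / p ⊗ₖ B / (y)` is the quotient of `A ⊗ B` by the extension of
`p`. -/
theorem exists_glue_factor {p : Ideal A} (hp : algebraMap k[X] A X ∈ p) :
    ∃ ρ : A ⊗[k[X]] B →+* (A ⧸ p) ⊗[k] (B ⧸ Ideal.span {algebraMap k[X] B X}),
      Function.Surjective ρ ∧ RingHom.ker ρ = p.map (algebraMap A (A ⊗[k[X]] B)) ∧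
      ∀ r, ρ (glue k A B r) = Algebra.TensorProduct.map (Ideal.Quotient.mkₐ k p)
        (Ideal.Quotient.mkₐ k (Ideal.span {algebraMap k[X] B X})) r := by
  let φ := Algebra.TensorProduct.map (Ideal.Quotient.mkₐ k p)
        (Ideal.Quotient.mkₐ k (Ideal.span {algebraMap k[X] B X}))
  have hkerφ : RingHom.ker φ = _ :=
    (ker_map_quotient_quotient p _).trans (extLeft_sup_extRight_span_eq hp)
  have hle : RingHom.ker (glue k A B).toRingHom ≤ RingHom.ker φ.toRingHom :=
    (ker_glue k A B).le.trans (le_sup_right.trans hkerφ.ge)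
  let ρ := (glue k A B).toRingHom.liftOfSurjective (glue_surjective k A B) ⟨φ.toRingHom, hle⟩
  have hρ (r : A ⊗[k] B) : ρ (glue k A B r) = φ r :=
    RingHom.liftOfSurjective_comp_apply _ (glue_surjective k A B) ⟨φ.toRingHom, hle⟩ r
  refine ⟨ρ, fun c => ?_, ?_, hρ⟩
  · obtain ⟨r, rfl⟩ := map_quotient_quotient_surjective p _ c
    exact ⟨_, hρ r⟩
  · apply Ideal.comap_injective_of_surjective (glue k A B) (glue_surjective k A B)
    rw [← map_glue_includeLeft, comap_glue_map, ← hkerφ]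
    ext r
    rw [Ideal.mem_comap, RingHom.mem_ker, hρ, RingHom.mem_ker]

variable [Algebra.FiniteType k A] [Algebra.FiniteType k B]

/-- When `x ∈ p`, the associated primes of `J C / p J C`, pulled back to `A ⊗ₖ B`. -/
theorem image_comap_glue_associatedPrimes {ι : Type*} (e : B ≃ₐ[k[X]] MvPolynomial ι k[X])
    (p : Ideal A) [p.IsPrime] (hp : algebraMap k[X] A X ∈ p) {J : Ideal B} (hJ : J ≠ ⊥) :
    Ideal.comap (glue k A B) '' associatedPrimes (A ⊗[k[X]] B)
        (((A ⊗[k[X]] B) ⊗[B] J) ⊗[A] (A ⧸ p)) =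
      {p.map (Algebra.TensorProduct.includeLeft : A →ₐ[k] A ⊗[k] B) ⊔ glueIdeal k A B} ∪
      ⋃ q ∈ {q | q ∈ Ass J ∧ algebraMap k[X] B X ∈ q},
        (p.map (Algebra.TensorProduct.includeLeft : A →ₐ[k] A ⊗[k] B) ⊔
          q.map (Algebra.TensorProduct.includeRight : B →ₐ[k] A ⊗[k] B)).minimalPrimes := by
  have hy : Prime (algebraMap k[X] B X) := prime_algebraMap_X e
  have : IsDomain B := e.toMulEquiv.isDomain _
  have : IsNoetherianRing B := Algebra.FiniteType.isNoetherianRing k B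
  let B₁ := B ⧸ Ideal.span {algebraMap k[X] B X}
  let C₁ := (A ⧸ p) ⊗[k] B₁
  obtain ⟨ρ, hρsurj, hkerρ, hρ⟩ := exists_glue_factor (B := B) hp
  have : Module.Flat B₁ C₁ := flat_right
  have hAss := image_comap_mk_associatedPrimes_tensor hy hJ
  have hp' : (p.map (Algebra.TensorProduct.includeLeft : A →ₐ[k] A ⊗[k] B) ⊔
      glueIdeal k A B).IsPrime := by
    have := isPrime_map_left e p
    rw [← comap_glue_map, map_glue_includeLeft]
    infer_instance
  have h1 := associatedPrimes_tensor_quotient_of_factor (B₁ := B₁) (C₁ := C₁) ρ hρsurj hkerρ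
    (fun b => hρ (1 ⊗ₜ b)) J
  have h3 : (fun Q : Ideal C₁ => (Q.comap ρ).comap (glue k A B)) =
      Ideal.comap (Algebra.TensorProduct.map (Ideal.Quotient.mkₐ k p)
        (Ideal.Quotient.mkₐ k (Ideal.span {algebraMap k[X] B X}))) := by
    funext Q
    ext r
    simp only [Ideal.mem_comap, hρ]
  rw [h1, Set.image_image]
  refine (congrArg (· '' _) h3).trans ?_
  rw [Set.image_iUnion₂, ← Ideal.minimalPrimes_eq_subsingleton_self,
    ← extLeft_sup_extRight_span_eq hp, ← Set.biUnion_singleton (Ideal.span _)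
      (fun q : Ideal B => (p.map (Algebra.TensorProduct.includeLeft : A →ₐ[k] A ⊗[k] B) ⊔
          q.map (Algebra.TensorProduct.includeRight : B →ₐ[k] A ⊗[k] B)).minimalPrimes),
    ← Set.biUnion_union, ← hAss, Set.biUnion_image]
  refine Set.iUnion₂_congr fun q₁ h => ?_
  have : q₁.IsPrime := h.1
  rw [image_comap_ass_map_quotient]
  have : (q₁.comap (Ideal.Quotient.mk (Ideal.span {algebraMap k[X] B X}))).IsPrime := inferInstance
  exact associatedPrimes_quotient_extLeft_sup_extRight _ _

end

/-! ### Associated primes of `IJ + (x - y)` -/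

section

open Polynomial

attribute [local instance] Algebra.TensorProduct.rightAlgebra

variable {k A B : Type*} [Field k] [CommRing A] [CommRing B] [Algebra k A] [Algebra k B]
  [Algebra k[X] A] [Algebra k[X] B] [IsScalarTower k k[X] A] [IsScalarTower k k[X] B]

theorem ass_mul_sup_glueIdeal (I : Ideal A) (J : Ideal B) :
    Ass (I.map (Algebra.TensorProduct.includeLeft : A →ₐ[k] A ⊗[k] B) *
        J.map (Algebra.TensorProduct.includeRight : B →ₐ[k] A ⊗[k] B) ⊔ glueIdeal k A B) =
      Ideal.comap (glue k A B) '' Ass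
        (I.map (algebraMap A (A ⊗[k[X]] B)) * J.map (algebraMap B (A ⊗[k[X]] B))) := by
  rw [ass_sup_glueIdeal, Ideal.map_mul, map_glue_includeLeft, map_glue_includeRight]

variable [Algebra.FiniteType k A] [Algebra.FiniteType k B] {ι κ : Type*}

theorem isNoetherianRing_tensor : IsNoetherianRing (A ⊗[k[X]] B) := by
  have : Algebra.FiniteType k (A ⊗[k] B) := Algebra.FiniteType.trans (S := A) ‹_› inferInstance
  have : IsNoetherianRing (A ⊗[k] B) := Algebra.FiniteType.isNoetherianRing k _
  exact isNoetherianRing_of_surjective _ _ (glue k A B).toRingHom (glue_surjective k A B)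

/-- When `p` meets `k[x]` in zero, the associated primes of `J C / p J C`, pulled back to
`A ⊗ₖ B`. -/
theorem image_comap_glue_associatedPrimes_of_injective (e : B ≃ₐ[k[X]] MvPolynomial ι k[X])
    (p : Ideal A) [p.IsPrime] (hp : Function.Injective (algebraMap k[X] (A ⧸ p)))
    {J : Ideal B} (hJ : J ≠ ⊥) :
    Ideal.comap (glue k A B) '' associatedPrimes (A ⊗[k[X]] B)
        (((A ⊗[k[X]] B) ⊗[B] J) ⊗[A] (A ⧸ p)) =
      {p.map (Algebra.TensorProduct.includeLeft : A →ₐ[k] A ⊗[k] B) ⊔ glueIdeal k A B} := by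
  have : IsNoetherianRing (A ⊗[k[X]] B) := isNoetherianRing_tensor
  rw [associatedPrimes_tensor_quotient_of_injective e p hp hJ, Set.image_singleton,
    ← map_glue_includeLeft, comap_glue_map]

theorem sup_glueIdeal_mem_ass (eA : A ≃ₐ[k[X]] MvPolynomial κ k[X])
    (eB : B ≃ₐ[k[X]] MvPolynomial ι k[X]) {I : Ideal A} {J : Ideal B}
    (hJ : J ≠ ⊥) {p : Ideal A} (hp : p ∈ Ass I)
    (hI : algebraMap k[X] A X ∈ p ∨ Function.Injective (algebraMap k[X] (A ⧸ p))) :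
    p.map (Algebra.TensorProduct.includeLeft : A →ₐ[k] A ⊗[k] B) ⊔ glueIdeal k A B ∈
      Ass (I.map (Algebra.TensorProduct.includeLeft : A →ₐ[k] A ⊗[k] B) *
        J.map (Algebra.TensorProduct.includeRight : B →ₐ[k] A ⊗[k] B) ⊔ glueIdeal k A B) := by
  have := hp.1
  have : Module.Flat k[X] A := Module.Flat.of_linearEquiv eA.toLinearEquiv
  have : Module.Flat B (A ⊗[k[X]] B) := flat_right
  rw [ass_mul_sup_glueIdeal]
  refine Set.image_mono (associatedPrimes_tensor_subset_ass_mul I J) ?_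
  have : IsNoetherianRing A := Algebra.FiniteType.isNoetherianRing k A
  rw [associatedPrimes_tensor_ideal_tensor_quotient eB, Set.image_iUnion₂]
  refine Set.mem_biUnion hp ?_
  rcases hI with h | h
  · rw [image_comap_glue_associatedPrimes eB p h hJ]
    exact Or.inl rfl
  · rw [image_comap_glue_associatedPrimes_of_injective eB p h hJ]
    rfl

/-- The minimal primes over `p + q` are associated to `IJ + (x - y)` when `x ∈ p` and `y ∈ q`. -/
theorem minimalPrimes_subset_ass (eA : A ≃ₐ[k[X]] MvPolynomial κ k[X])
    (eB : B ≃ₐ[k[X]] MvPolynomial ι k[X]) {I : Ideal A} {J : Ideal B}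
    (hJ : J ≠ ⊥) {p : Ideal A} (hp : p ∈ Ass I) {q : Ideal B} (hq : q ∈ Ass J)
    (hxp : algebraMap k[X] A X ∈ p) (hyq : algebraMap k[X] B X ∈ q) :
    (p.map (Algebra.TensorProduct.includeLeft : A →ₐ[k] A ⊗[k] B) ⊔
          q.map (Algebra.TensorProduct.includeRight : B →ₐ[k] A ⊗[k] B)).minimalPrimes ⊆
      Ass (I.map (Algebra.TensorProduct.includeLeft : A →ₐ[k] A ⊗[k] B) *
        J.map (Algebra.TensorProduct.includeRight : B →ₐ[k] A ⊗[k] B) ⊔ glueIdeal k A B) := by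
  have := hp.1
  have : Module.Flat k[X] A := Module.Flat.of_linearEquiv eA.toLinearEquiv
  have : Module.Flat B (A ⊗[k[X]] B) := flat_right
  intro P hP
  rw [ass_mul_sup_glueIdeal]
  refine Set.image_mono (associatedPrimes_tensor_subset_ass_mul I J) ?_
  have : IsNoetherianRing A := Algebra.FiniteType.isNoetherianRing k A
  rw [associatedPrimes_tensor_ideal_tensor_quotient eB, Set.image_iUnion₂]
  refine Set.mem_biUnion hp ?_
  rw [image_comap_glue_associatedPrimes eB p hxp hJ]
  exact Or.inr (Set.mem_biUnion (x := q) ⟨hq, hyq⟩ hP)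

theorem ass_mul_sup_glueIdeal_subset (eA : A ≃ₐ[k[X]] MvPolynomial κ k[X])
    (eB : B ≃ₐ[k[X]] MvPolynomial ι k[X]) {I : Ideal A} {J : Ideal B} (hJ : J ≠ ⊥)
    (hI : ∀ p ∈ Ass I,
      algebraMap k[X] A X ∈ p ∨ Function.Injective (algebraMap k[X] (A ⧸ p))) :
    Ass (I.map (Algebra.TensorProduct.includeLeft : A →ₐ[k] A ⊗[k] B) *
        J.map (Algebra.TensorProduct.includeRight : B →ₐ[k] A ⊗[k] B) ⊔ glueIdeal k A B) ⊆
      {P | ∃ p ∈ Ass I,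
        P = p.map (Algebra.TensorProduct.includeLeft : A →ₐ[k] A ⊗[k] B) ⊔ glueIdeal k A B} ∪
      {P | ∃ q ∈ Ass J,
        P = q.map (Algebra.TensorProduct.includeRight : B →ₐ[k] A ⊗[k] B) ⊔ glueIdeal k A B} ∪
      {P | ∃ p ∈ Ass I, ∃ q ∈ Ass J, algebraMap k[X] A X ∈ p ∧ algebraMap k[X] B X ∈ q ∧
        P ∈ (p.map (Algebra.TensorProduct.includeLeft : A →ₐ[k] A ⊗[k] B) ⊔
          q.map (Algebra.TensorProduct.includeRight : B →ₐ[k] A ⊗[k] B)).minimalPrimes} := by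
  have : Module.Flat k[X] A := Module.Flat.of_linearEquiv eA.toLinearEquiv
  have : Module.Flat B (A ⊗[k[X]] B) := flat_right
  have : IsNoetherianRing B := Algebra.FiniteType.isNoetherianRing k B
  have : IsNoetherianRing (A ⊗[k[X]] B) := isNoetherianRing_tensor
  rw [ass_mul_sup_glueIdeal]
  refine (Set.image_mono (ass_mul_subset I J)).trans ?_
  have : IsNoetherianRing A := Algebra.FiniteType.isNoetherianRing k A
  rw [Set.image_union, associatedPrimes_tensor_ideal_tensor_quotient eB, Set.image_iUnion₂,
    ass_map_right eA, Set.image_image]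
  refine Set.union_subset (Set.iUnion₂_subset fun p hp => ?_) ?_
  · have := hp.1
    rcases hI p hp with h | h
    · rw [image_comap_glue_associatedPrimes eB p h hJ]
      rintro P (rfl | hP)
      · exact Or.inl (Or.inl ⟨p, hp, rfl⟩)
      · obtain ⟨q, ⟨hq, hyq⟩, hP⟩ := Set.mem_iUnion₂.mp hP
        exact Or.inr ⟨p, hp, q, hq, h, hyq, hP⟩
    · rw [image_comap_glue_associatedPrimes_of_injective eB p h hJ]
      rintro P rfl
      exact Or.inl (Or.inl ⟨p, hp, rfl⟩)
  · rintro _ ⟨q, hq, rfl⟩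
    refine Or.inl (Or.inr ⟨q, hq, ?_⟩)
    change Ideal.comap (glue k A B) (q.map (algebraMap B (A ⊗[k[X]] B))) = _
    rw [← map_glue_includeRight, comap_glue_map]

end

section

open MvPolynomial

attribute [local instance] MvPolynomial.gradedAlgebra

/-- A polynomial in the variable `x` with nonzero constant coefficient is a nonzerodivisor modulo
a homogeneous ideal. -/
theorem mem_of_aeval_X_mul_mem {k σ : Type*} [Field k] {I : Ideal (MvPolynomial σ k)}
    (hI : IsHomogeneous I) (x : σ) {f : Polynomial k} (hf : f.coeff 0 ≠ 0)
    {a : MvPolynomial σ k} (ha : Polynomial.aeval (X x) f * a ∈ I) : a ∈ I := by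
  classical
  rw [hI.mem_iff]
  intro d
  induction d using Nat.strong_induction_on with
  | _ d ih =>
    have h : GradedAlgebra.proj (homogeneousSubmodule σ k) d (Polynomial.aeval (X x) f * a) ∈ I :=
      hI.mem_iff.mp ha d
    have hX (i : ℕ) : (X x ^ i : MvPolynomial σ k) ∈ homogeneousSubmodule σ k i :=
      (mem_homogeneousSubmodule _ _).mpr (isHomogeneous_X_pow x i)
    rw [Polynomial.aeval_eq_sum_range, Finset.sum_range_succ', add_mul, map_add, Finset.sum_mul,
      map_sum] at h
    -- only the constant coefficient of `f` multiplies the degree `d` component of `a`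
    have h' := (I.add_mem_iff_right (I.sum_mem fun i _ => ?_)).mp h
    · rw [pow_zero, smul_mul_assoc, one_mul, map_smul] at h'
      have := Submodule.smul_of_tower_mem I (f.coeff 0)⁻¹ h'
      rwa [smul_smul, inv_mul_cancel₀ hf, one_smul] at this
    · rw [smul_mul_assoc, map_smul, GradedAlgebra.proj_apply,
        DirectSum.coe_decompose_mul_of_left_mem _ d (hX (i + 1))]
      refine Submodule.smul_of_tower_mem I _ ?_
      split_ifs with hid
      · exact I.mul_mem_left _ (ih _ (by omega))
      · exact I.zero_mem

/-- The `k[X]`-algebra structure on a polynomial ring in which `X` acts as the variable `x`. -/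
noncomputable abbrev variableAlgebra (k : Type*) {σ : Type*} [Field k] (x : σ) :
    Algebra (Polynomial k) (MvPolynomial σ k) :=
  (Polynomial.aeval (X x : MvPolynomial σ k)).toRingHom.toAlgebra

theorem algebraMap_variableAlgebra_X (k : Type*) {σ : Type*} [Field k] (x : σ) :
    letI := variableAlgebra k x
    algebraMap (Polynomial k) (MvPolynomial σ k) Polynomial.X = X x :=
  Polynomial.aeval_X _

theorem isScalarTower_variableAlgebra (k : Type*) {σ : Type*} [Field k] (x : σ) :
    letI := variableAlgebra k x
    IsScalarTower k (Polynomial k) (MvPolynomial σ k) :=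
  letI := variableAlgebra k x
  IsScalarTower.of_algebraMap_eq fun c => (Polynomial.aeval_C (X x : MvPolynomial σ k) c).symm

theorem glueIdeal_variableAlgebra (k : Type*) {σ τ : Type*} [Field k] (x : σ) (y : τ) :
    letI := variableAlgebra k x
    letI := variableAlgebra k y
    glueIdeal k (MvPolynomial σ k) (MvPolynomial τ k) = diffIdeal k x y := by
  simp only [glueIdeal, algebraMap_variableAlgebra_X]

/-- A polynomial ring is a polynomial ring over `k[X]` in the variables other than `x`. -/
theorem exists_algEquiv_variableAlgebra (k : Type*) {σ : Type*} [Field k] (x : σ) :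
    letI := variableAlgebra k x
    Nonempty (MvPolynomial σ k ≃ₐ[Polynomial k] MvPolynomial {s // s ≠ x} (Polynomial k)) := by
  classical
  let := variableAlgebra k x
  let e : MvPolynomial σ k ≃ₐ[k] MvPolynomial {s // s ≠ x} (Polynomial k) :=
    (renameEquiv k (Equiv.optionSubtypeNe x).symm).trans (optionEquivRight k _)
  have h : e.toAlgHom.comp (Polynomial.aeval (X x)) =
      IsScalarTower.toAlgHom k (Polynomial k) _ := by
    refine Polynomial.algHom_ext ?_
    simp [e, MvPolynomial.algebraMap_eq]
  exact ⟨{ e with commutes' := fun s => DFunLike.congr_fun h s }⟩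

/-- The dichotomy for the associated primes `p` of a homogeneous ideal: either `x ∈ p`, or
`k[x]` meets `p` in zero only. -/
theorem algebraMap_X_mem_or_injective {k σ : Type*} [Field k] [Finite σ]
    {I : Ideal (MvPolynomial σ k)} (hI : IsHomogeneous I) (x : σ) {p : Ideal (MvPolynomial σ k)}
    (hp : p ∈ Ass I) :
    letI := variableAlgebra k x
    algebraMap (Polynomial k) (MvPolynomial σ k) Polynomial.X ∈ p ∨
      Function.Injective (algebraMap (Polynomial k) (MvPolynomial σ k ⧸ p)) := by
  let := variableAlgebra k x
  obtain ⟨hprime, a, ha⟩ := mem_ass_iff.mp hp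
  refine or_iff_not_imp_left.mpr fun hx => ?_
  rw [algebraMap_variableAlgebra_X] at hx
  rw [injective_iff_map_eq_zero]
  intro f hf
  replace hf : Polynomial.aeval (X x) f ∈ p := Ideal.Quotient.eq_zero_iff_mem.mp hf
  by_contra hf0
  obtain ⟨n, g, hg0, rfl⟩ : ∃ n g, Polynomial.coeff g 0 ≠ 0 ∧ f = Polynomial.X ^ n * g := by
    obtain ⟨g, hg, hndvd⟩ := Polynomial.exists_eq_pow_rootMultiplicity_mul_and_not_dvd f hf0 0
    rw [map_zero, sub_zero] at hg hndvd
    exact ⟨_, g, fun h => hndvd (Polynomial.X_dvd_iff.mpr h), hg⟩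
  -- as `p` is the annihilator of `a` modulo `I`, the factor `g` with `g 0 ≠ 0` cannot lie in `p`
  rw [map_mul, map_pow, Polynomial.aeval_X] at hf
  have hg := (hprime.mem_or_mem hf).resolve_left fun h => hx (hprime.mem_of_pow_mem n h)
  have := mem_of_aeval_X_mul_mem hI x hg0 ((ha _).mp hg)
  exact hprime.ne_top ((Ideal.eq_top_iff_one _).mpr ((ha 1).mpr (by rwa [one_mul])))

/-- Associated primes are carried along ring isomorphisms. -/
theorem map_mem_ass {R R' : Type*} [CommRing R] [CommRing R'] (f : R ≃+* R') {K P : Ideal R}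
    (h : P ∈ Ass K) : P.map (f : R →+* R') ∈ Ass (K.map (f : R →+* R')) := by
  let : Algebra R R' := (f : R →+* R').toAlgebra
  rw [Ass, associatedPrimes_quotient_eq_image_comap (C := R') f.surjective K
    (((RingHom.injective_iff_ker_eq_bot _).mp f.injective).le.trans bot_le)] at h
  obtain ⟨Q, hQ, rfl⟩ := h
  have : (Q.comap (f : R →+* R')).map (f : R →+* R') = Q :=
    Ideal.map_comap_of_surjective _ f.surjective Q
  exact this.symm ▸ hQ

end

section

variable {k σ τ : Type*} [Field k]

theorem map_comm_extLeft (J : Ideal (MvPolynomial τ k)) :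
    (extLeft σ J).map
      ((Algebra.TensorProduct.comm k (MvPolynomial τ k) (MvPolynomial σ k)).toRingEquiv :
      MvPolynomial τ k ⊗[k] MvPolynomial σ k →+* MvPolynomial σ k ⊗[k] MvPolynomial τ k) =
      extRight σ J :=
  Ideal.map_map (Algebra.TensorProduct.includeLeft :
    MvPolynomial τ k →ₐ[k] MvPolynomial τ k ⊗[k] MvPolynomial σ k).toRingHom _

theorem map_comm_extRight (I : Ideal (MvPolynomial σ k)) :
    (extRight τ I).map
      ((Algebra.TensorProduct.comm k (MvPolynomial τ k) (MvPolynomial σ k)).toRingEquiv :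
      MvPolynomial τ k ⊗[k] MvPolynomial σ k →+* MvPolynomial σ k ⊗[k] MvPolynomial τ k) =
      extLeft τ I :=
  Ideal.map_map (Algebra.TensorProduct.includeRight :
    MvPolynomial σ k →ₐ[k] MvPolynomial τ k ⊗[k] MvPolynomial σ k).toRingHom _

theorem map_comm_diffIdeal (x : σ) (y : τ) :
    (diffIdeal k y x).map
      ((Algebra.TensorProduct.comm k (MvPolynomial τ k) (MvPolynomial σ k)).toRingEquiv :
      MvPolynomial τ k ⊗[k] MvPolynomial σ k →+* MvPolynomial σ k ⊗[k] MvPolynomial τ k) =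
      diffIdeal k x y := by
  rw [diffIdeal, diffIdeal, Ideal.map_span, Set.image_singleton, ← Ideal.span_singleton_neg]
  congr 2
  simp

variable [Finite σ] [Finite τ]

/-- The extensions `(p, x - y)` of the associated primes `p` of `I` are associated to
`(IJ, x - y)`. -/
theorem extLeft_sup_diffIdeal_mem_ass {I : Ideal (MvPolynomial σ k)} {J : Ideal (MvPolynomial τ k)}
    (hI : IsHomogeneous I) (hJ : J ≠ ⊥) (x : σ) (y : τ) {p : Ideal (MvPolynomial σ k)}
    (hp : p ∈ Ass I) :
    extLeft τ p ⊔ diffIdeal k x y ∈ Ass (extLeft τ I * extRight σ J ⊔ diffIdeal k x y) := by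
  let := variableAlgebra k x
  let := variableAlgebra k y
  obtain ⟨eA⟩ := exists_algEquiv_variableAlgebra k x
  obtain ⟨eB⟩ := exists_algEquiv_variableAlgebra k y
  have := isScalarTower_variableAlgebra k x
  have := isScalarTower_variableAlgebra k y
  rw [← glueIdeal_variableAlgebra]
  exact sup_glueIdeal_mem_ass eA eB hJ hp (algebraMap_X_mem_or_injective hI x hp)

end

end AssProduct

theorem proposition3p2 {k σ τ : Type*} [Field k] [Finite σ] [Finite τ]
    (I : Ideal (MvPolynomial σ k)) (J : Ideal (MvPolynomial τ k))
    (hI : AssProduct.IsHomogeneous I)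
    (hJ : AssProduct.IsHomogeneous J)
    (hI_ne_bot : I ≠ ⊥) (hI_ne_top : I ≠ ⊤) (hJ_ne_bot : J ≠ ⊥) (hJ_ne_top : J ≠ ⊤)
    (x : σ) (y : τ) :
    AssProduct.Ass
        (AssProduct.extLeft τ I * AssProduct.extRight σ J ⊔ AssProduct.diffIdeal k x y) =
      {P | ∃ p ∈ AssProduct.Ass I, P = AssProduct.extLeft τ p ⊔ AssProduct.diffIdeal k x y} ∪
      {P | ∃ q ∈ AssProduct.Ass J, P = AssProduct.extRight σ q ⊔ AssProduct.diffIdeal k x y} ∪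
      {P | ∃ p ∈ AssProduct.Ass I, ∃ q ∈ AssProduct.Ass J,
        MvPolynomial.X x ∈ p ∧ MvPolynomial.X y ∈ q ∧
        P ∈ (AssProduct.extLeft τ p ⊔ AssProduct.extRight σ q).minimalPrimes} := by
  apply subset_antisymm
  · let := AssProduct.variableAlgebra k x
    let := AssProduct.variableAlgebra k y
    obtain ⟨eA⟩ := AssProduct.exists_algEquiv_variableAlgebra k x
    obtain ⟨eB⟩ := AssProduct.exists_algEquiv_variableAlgebra k y
    have := AssProduct.isScalarTower_variableAlgebra k x
    have := AssProduct.isScalarTower_variableAlgebra k y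
    have h := AssProduct.ass_mul_sup_glueIdeal_subset eA eB hJ_ne_bot
      (fun p hp => AssProduct.algebraMap_X_mem_or_injective hI x hp)
    rw [AssProduct.glueIdeal_variableAlgebra, AssProduct.algebraMap_variableAlgebra_X,
      AssProduct.algebraMap_variableAlgebra_X] at h
    exact h
  · refine Set.union_subset (Set.union_subset ?_ ?_) ?_
    · rintro _ ⟨p, hp, rfl⟩
      exact AssProduct.extLeft_sup_diffIdeal_mem_ass hI hJ_ne_bot x y hp
    · -- the roles of `A` and `B` are exchanged by the symmetry of the tensor product
      rintro _ ⟨q, hq, rfl⟩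
      have h := AssProduct.map_mem_ass
        (Algebra.TensorProduct.comm k (MvPolynomial τ k) (MvPolynomial σ k)).toRingEquiv
        (AssProduct.extLeft_sup_diffIdeal_mem_ass hJ hI_ne_bot y x hq)
      rwa [Ideal.map_sup, Ideal.map_sup, Ideal.map_mul, AssProduct.map_comm_extLeft,
        AssProduct.map_comm_extLeft, AssProduct.map_comm_extRight,
        AssProduct.map_comm_diffIdeal, mul_comm] at h
    · rintro P ⟨p, hp, q, hq, hxp, hyq, hP⟩
      let := AssProduct.variableAlgebra k x
      let := AssProduct.variableAlgebra k y
      obtain ⟨eA⟩ := AssProduct.exists_algEquiv_variableAlgebra k x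
      obtain ⟨eB⟩ := AssProduct.exists_algEquiv_variableAlgebra k y
      have := AssProduct.isScalarTower_variableAlgebra k x
      have := AssProduct.isScalarTower_variableAlgebra k y
      rw [← AssProduct.glueIdeal_variableAlgebra]
      rw [← AssProduct.algebraMap_variableAlgebra_X k x] at hxp
      rw [← AssProduct.algebraMap_variableAlgebra_X k y] at hyq
      exact AssProduct.minimalPrimes_subset_ass eA eB hJ_ne_bot hp hq hxp hyq hP
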